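/- For $n\ge 0$ let $PD_2(n)$ be the number of partitions of $n$ with designated summands in which all parts are odd; that is, the number of ways to choose a partition of $n$ into odd parts and, for each part size occurring in it, to designate exactly one of the occurrences of that part (so $PD_2(0)=1$ and $PD_2(4)=5$). Then for all $n\ge 0$, $$PD_2(16n)\equiv PD_2(4n)\pmod 8.$$ -/

import Mathlib

/-- A `k`-regular partition of `n` with designated summands: a partition of `n` none of whose
parts is divisible by `k`, together with, for each part size `i` that occurs in it, the choice of
one of the `count i` occurrences of `i` (the designated one). -/
abbrev DesignatedPartition (k n : ℕ) : Type :=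
  Σ p : {p : n.Partition // ∀ i ∈ p.parts, ¬ k ∣ i},
    (i : {i : ℕ // i ∈ p.1.parts}) → Fin (p.1.parts.count i.1)

/-- `PD k n` is the number of `k`-regular partitions of `n` with designated summands. For `k = 2`
all parts are odd. -/
noncomputable def PD (k n : ℕ) : ℕ := Nat.card (DesignatedPartition k n)

/-- There are finitely many such objects, so that `PD` really counts them. -/
theorem finite_designatedPartition (k n : ℕ) : Finite (DesignatedPartition k n) := by
  have h : ∀ p : {p : n.Partition // ∀ i ∈ p.parts, ¬ k ∣ i},
      Finite {i : ℕ // i ∈ p.1.parts} := fun p =>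
    Finite.of_injective (fun i => (⟨i.1, Multiset.mem_toFinset.2 i.2⟩ : p.1.parts.toFinset))
      (fun a b hab => Subtype.ext (congrArg (fun z => z.1) hab))
  infer_instance

/-! Let `G` be the generating function, `∏ (1 - q^i + q^(2i)) / (1 - q^i)^2` over odd `i`. The
Jacobi triple product at `z = ω` (a primitive cube root of unity) and at `z = -1` gives `2 G θ(-q) =
∑ (ω^x + ω^(-x)) q^(x^2)`, where `θ(q) = ∑ q^(x^2)` (`two_mul_mul_theta_parity`). Multiplying by
`θ(q)` makes `θ(-q) θ(q)` a series in `q^2`. Substituting `(a + b, a - b)` in sums of two squares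
then shows that the even part of `G` is `G^2` and that its odd part `H` is `K^2` modulo 4, with `K`
a series in `q^2` (`dissection_of_theta`). The rest is algebra (`eight_dvd_of_dissection`). Two even
parts of `G` give `Q = G^4 + q H^2`; two more give `Q^4 + q k^8` modulo 8, where `K(q) = k(q^2)`.
Since `F(q^2) ≡ F^2` modulo 2, both `G ≡ Q` and `K ≡ k^2` modulo 2. Fourth powers turn these into
congruences modulo 8, so `Q^4 + q k^8 ≡ G^4 + q H^2 = Q`. -/

open PowerSeries

/-! ### Even and odd parts of power series -/

/-- The series of even-indexed coefficients of a power series. -/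
noncomputable def evenPart (F : ℤ⟦X⟧) : ℤ⟦X⟧ := PowerSeries.mk fun n => coeff (2 * n) F

/-- The series of odd-indexed coefficients of a power series. -/
noncomputable def oddPart (F : ℤ⟦X⟧) : ℤ⟦X⟧ := PowerSeries.mk fun n => coeff (2 * n + 1) F

/-- The substitution `X ↦ X ^ 2`. -/
noncomputable abbrev expandTwo (F : ℤ⟦X⟧) : ℤ⟦X⟧ := expand 2 two_ne_zero F

@[simp] theorem coeff_evenPart (F : ℤ⟦X⟧) (n : ℕ) : coeff n (evenPart F) = coeff (2 * n) F :=
  coeff_mk _ _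

@[simp] theorem coeff_oddPart (F : ℤ⟦X⟧) (n : ℕ) : coeff n (oddPart F) = coeff (2 * n + 1) F :=
  coeff_mk _ _

theorem coeff_two_mul_expandTwo (F : ℤ⟦X⟧) (n : ℕ) : coeff (2 * n) (expandTwo F) = coeff n F := by
  simp [expandTwo]

theorem coeff_two_mul_add_one_expandTwo (F : ℤ⟦X⟧) (n : ℕ) :
    coeff (2 * n + 1) (expandTwo F) = 0 := by
  rw [expandTwo, coeff_expand_of_not_dvd]
  omega

theorem evenPart_dissection (A B : ℤ⟦X⟧) :
    evenPart (expandTwo A + X * expandTwo B) = A := by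
  ext n
  rw [coeff_evenPart, map_add, coeff_two_mul_expandTwo]
  rcases n with _ | n
  · simp
  · rw [show 2 * (n + 1) = (2 * n + 1) + 1 by ring, coeff_succ_X_mul,
      coeff_two_mul_add_one_expandTwo, add_zero]

theorem oddPart_dissection (A B : ℤ⟦X⟧) :
    oddPart (expandTwo A + X * expandTwo B) = B := by
  ext n
  rw [coeff_oddPart, map_add, coeff_two_mul_add_one_expandTwo, coeff_succ_X_mul,
    coeff_two_mul_expandTwo, zero_add]

theorem dissection (F : ℤ⟦X⟧) :
    F = expandTwo (evenPart F) + X * expandTwo (oddPart F) := by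
  ext n
  obtain ⟨k, rfl | rfl⟩ := n.even_or_odd'
  · rw [← coeff_evenPart, ← coeff_evenPart, evenPart_dissection]
  · rw [← coeff_oddPart, ← coeff_oddPart, oddPart_dissection]

theorem mul_dissection (F G : ℤ⟦X⟧) :
    F * G = expandTwo (evenPart F * evenPart G + X * (oddPart F * oddPart G)) +
      X * expandTwo (evenPart F * oddPart G + oddPart F * evenPart G) := by
  conv_lhs => rw [dissection F, dissection G]
  simp only [expandTwo, map_add, map_mul, expand_X]
  ring

theorem evenPart_mul (F G : ℤ⟦X⟧) :
    evenPart (F * G) = evenPart F * evenPart G + X * (oddPart F * oddPart G) := by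
  rw [mul_dissection, evenPart_dissection]

theorem oddPart_mul (F G : ℤ⟦X⟧) :
    oddPart (F * G) = evenPart F * oddPart G + oddPart F * evenPart G := by
  rw [mul_dissection, oddPart_dissection]

theorem evenPart_add (F G : ℤ⟦X⟧) : evenPart (F + G) = evenPart F + evenPart G := by
  ext n; simp

theorem oddPart_add (F G : ℤ⟦X⟧) : oddPart (F + G) = oddPart F + oddPart G := by
  ext n; simp

theorem oddPart_sub (F G : ℤ⟦X⟧) : oddPart (F - G) = oddPart F - oddPart G := by
  ext n; simp

theorem evenPart_natCast (m : ℕ) : evenPart (m : ℤ⟦X⟧) = m := by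
  ext n
  rw [coeff_evenPart, ← map_natCast (C (R := ℤ)), coeff_C, coeff_C]
  simp

theorem oddPart_natCast (m : ℕ) : oddPart (m : ℤ⟦X⟧) = 0 := by
  ext n
  rw [coeff_oddPart, ← map_natCast (C (R := ℤ)), coeff_C]
  simp

theorem evenPart_natCast_mul (m : ℕ) (F : ℤ⟦X⟧) : evenPart (m * F) = m * evenPart F := by
  rw [evenPart_mul, evenPart_natCast, oddPart_natCast]; ring

theorem oddPart_natCast_mul (m : ℕ) (F : ℤ⟦X⟧) : oddPart (m * F) = m * oddPart F := by
  rw [oddPart_mul, evenPart_natCast, oddPart_natCast]; ring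

theorem evenPart_X : evenPart (X : ℤ⟦X⟧) = 0 := by
  ext n
  rw [coeff_evenPart, coeff_X, if_neg (by omega), map_zero]

theorem oddPart_X : oddPart (X : ℤ⟦X⟧) = 1 := by
  ext n
  rw [coeff_oddPart, coeff_X, coeff_one]
  simp

theorem evenPart_X_mul (F : ℤ⟦X⟧) : evenPart (X * F) = X * oddPart F := by
  rw [evenPart_mul, evenPart_X, oddPart_X]; ring

theorem oddPart_X_mul (F : ℤ⟦X⟧) : oddPart (X * F) = evenPart F := by
  rw [oddPart_mul, evenPart_X, oddPart_X]; ring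

theorem evenPart_sq (F : ℤ⟦X⟧) :
    evenPart (F ^ 2) = evenPart F ^ 2 + X * oddPart F ^ 2 := by
  rw [sq, evenPart_mul]; ring

theorem oddPart_sq (F : ℤ⟦X⟧) : oddPart (F ^ 2) = 2 * (evenPart F * oddPart F) := by
  rw [sq, oddPart_mul]; ring

theorem natCast_dvd_iff_coeff (m : ℕ) (F : ℤ⟦X⟧) :
    (m : ℤ⟦X⟧) ∣ F ↔ ∀ n, (m : ℤ) ∣ coeff n F := by
  constructor
  · rintro ⟨G, rfl⟩ n
    rw [← map_natCast (C (R := ℤ)), coeff_C_mul]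
    exact dvd_mul_right _ _
  · intro h
    choose g hg using h
    refine ⟨PowerSeries.mk g, ?_⟩
    ext n
    rw [← map_natCast (C (R := ℤ)), coeff_C_mul, coeff_mk, hg]

/-- Over `ZMod 2` squaring is the Frobenius map, which fixes the coefficients. -/
theorem two_dvd_sq_sub_expandTwo (F : ℤ⟦X⟧) : (2 : ℤ⟦X⟧) ∣ F ^ 2 - expandTwo F := by
  have h := (natCast_dvd_iff_coeff 2 (F ^ 2 - expandTwo F)).2
  rw [Nat.cast_ofNat] at h
  apply h
  intro n
  have key : PowerSeries.map (Int.castRingHom (ZMod 2)) (F ^ 2 - expandTwo F) = 0 := by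
    have h2 : (PowerSeries.map (Int.castRingHom (ZMod 2)) F).expand 2 two_ne_zero =
        (PowerSeries.map (Int.castRingHom (ZMod 2)) F) ^ 2 := by
      have h3 := MvPowerSeries.map_frobenius_expand 2 two_ne_zero
        (f := PowerSeries.map (Int.castRingHom (ZMod 2)) F)
      rw [ZMod.frobenius_zmod, MvPowerSeries.map_id] at h3
      exact h3
    rw [map_sub, map_pow, expandTwo, map_expand, h2, sub_self]
  have h4 := congrArg (coeff n) key
  rw [coeff_map, map_zero, eq_intCast] at h4
  exact (ZMod.intCast_zmod_eq_zero_iff_dvd _ 2).1 h4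

/-! ### The congruence modulo 8 from the dissection of `G` -/

/-- If the even part of `G` is `G ^ 2` and its odd part is a square `K ^ 2` of an even series
modulo `4`, then taking the even part four times and twice agree modulo `8`. -/
theorem eight_dvd_of_dissection {G K L : ℤ⟦X⟧} (hU : evenPart G = G ^ 2)
    (hV : oddPart G = K ^ 2 + 4 * L) (hK : oddPart K = 0) :
    (8 : ℤ⟦X⟧) ∣ evenPart (evenPart (evenPart (evenPart G))) - evenPart (evenPart G) := by
  set H := oddPart G with hH
  obtain ⟨Z, hZ⟩ := two_dvd_sq_sub_expandTwo (evenPart K)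
  obtain ⟨Z₁, hZ₁⟩ := two_dvd_sq_sub_expandTwo (G ^ 2)
  obtain ⟨Z₂, hZ₂⟩ := two_dvd_sq_sub_expandTwo H
  have hKe : expandTwo (evenPart K) = K := by
    conv_rhs => rw [dissection K, hK]
    simp [expandTwo]
  have hG := dissection G
  rw [hU, ← hH] at hG
  have e2 : ∀ F : ℤ⟦X⟧, evenPart (2 * F) = 2 * evenPart F := fun F => evenPart_natCast_mul 2 F
  have e4 : ∀ F : ℤ⟦X⟧, evenPart (4 * F) = 4 * evenPart F := fun F => evenPart_natCast_mul 4 F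
  have o4 : ∀ F : ℤ⟦X⟧, oddPart (4 * F) = 4 * oddPart F := fun F => oddPart_natCast_mul 4 F
  set k := evenPart K with hk
  set l := evenPart L with hl
  set m := oddPart L with hm
  have hUH : evenPart H = k ^ 2 + 4 * l := by
    rw [hV, evenPart_add, evenPart_sq, hK, e4]; ring
  have hVH : oddPart H = 4 * m := by
    rw [hV, oddPart_add, oddPart_sq, hK, o4]; ring
  have hU2 : evenPart (G ^ 2) = G ^ 4 + X * H ^ 2 := by
    rw [evenPart_sq, hU, ← hH]; ring
  have hV2 : oddPart (G ^ 2) = 2 * (G ^ 2 * H) := by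
    rw [oddPart_sq, hU, ← hH]
  -- By `hU` and `hU2`, `Q` is the even part of the even part of `G`.
  set Q := G ^ 4 + X * H ^ 2 with hQ
  have hUG4 : evenPart (G ^ 4) = Q ^ 2 + 4 * (X * (G ^ 2 * H) ^ 2) := by
    rw [show G ^ 4 = (G ^ 2) ^ 2 by ring, evenPart_sq, hU2, hV2]; ring
  have hVG4 : oddPart (G ^ 4) = 4 * (Q * (G ^ 2 * H)) := by
    rw [show G ^ 4 = (G ^ 2) ^ 2 by ring, oddPart_sq, hU2, hV2]; ring
  have hUQ : evenPart Q =
      Q ^ 2 + 4 * (X * (G ^ 2 * H) ^ 2) + 8 * (X * ((k ^ 2 + 4 * l) * m)) := by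
    rw [hQ, evenPart_add, hUG4, evenPart_X_mul, oddPart_sq, hUH, hVH]; ring
  have hVQ : oddPart Q =
      4 * (Q * (G ^ 2 * H)) + (k ^ 2 + 4 * l) ^ 2 + X * (4 * m) ^ 2 := by
    rw [hQ, oddPart_add, hVG4, oddPart_X_mul, evenPart_sq, hUH, hVH]; ring
  -- `K` and `k ^ 2` agree modulo 2, and so do `G` and `Q` below; `d3` and `d4` raise this to fourth
  -- powers modulo 8.
  have hZ' : K = k ^ 2 - 2 * Z := by rw [← hZ, hKe]; ring
  have hGQ : G = Q - 2 * (Z₁ + X * Z₂) := by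
    have a : expandTwo (G ^ 2) = G ^ 4 - 2 * Z₁ := by rw [← hZ₁]; ring
    have b : expandTwo H = H ^ 2 - 2 * Z₂ := by rw [← hZ₂]; ring
    rw [a, b] at hG
    rw [hQ]
    linear_combination hG
  have e8 : ∀ F : ℤ⟦X⟧, evenPart (8 * F) = 8 * evenPart F := fun F => evenPart_natCast_mul 8 F
  -- The term with factor 4 in `hUQ` is `X` times a square. Its even part is the odd part of that
  -- square, which brings another factor 2.
  have hB : ∃ R, evenPart (evenPart Q) = evenPart Q ^ 2 + X * oddPart Q ^ 2 + 8 * R := by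
    refine ⟨X * (evenPart (G ^ 2 * H) * oddPart (G ^ 2 * H)) +
      evenPart (X * ((k ^ 2 + 4 * l) * m)), ?_⟩
    conv_lhs => rw [hUQ]
    rw [evenPart_add, evenPart_add, evenPart_sq, e4, e8, evenPart_X_mul, oddPart_sq]
    ring
  obtain ⟨R, hR⟩ := hB
  have d1 : (8 : ℤ⟦X⟧) ∣ evenPart Q ^ 2 - Q ^ 4 := by
    rw [hUQ]
    generalize X * (G ^ 2 * H) ^ 2 = A
    generalize X * ((k ^ 2 + 4 * l) * m) = B
    exact ⟨Q ^ 2 * A + 2 * Q ^ 2 * B + 2 * A ^ 2 + 8 * A * B + 8 * B ^ 2, by ring⟩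
  -- `oddPart Q` is `k ^ 4` modulo 4; squaring gains a factor 2.
  have d2 : (8 : ℤ⟦X⟧) ∣ oddPart Q ^ 2 - k ^ 8 := by
    rw [hVQ]
    generalize Q * (G ^ 2 * H) = A
    obtain ⟨B, hB⟩ : ∃ B, 4 * A + (k ^ 2 + 4 * l) ^ 2 + X * (4 * m) ^ 2 = k ^ 4 + 4 * B :=
      ⟨A + 2 * k ^ 2 * l + 4 * l ^ 2 + 4 * X * m ^ 2, by ring⟩
    rw [hB]
    exact ⟨k ^ 4 * B + 2 * B ^ 2, by ring⟩
  have d3 : (8 : ℤ⟦X⟧) ∣ k ^ 8 - H ^ 2 := by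
    rw [hV, hZ']
    exact ⟨k ^ 6 * Z - 3 * k ^ 4 * Z ^ 2 + 4 * k ^ 2 * Z ^ 3 - 2 * Z ^ 4 -
      (k ^ 2 - 2 * Z) ^ 2 * L - 2 * L ^ 2, by ring⟩
  have d4 : (8 : ℤ⟦X⟧) ∣ Q ^ 4 - G ^ 4 := by
    rw [hGQ]
    generalize Z₁ + X * Z₂ = W
    exact ⟨Q ^ 3 * W - 3 * Q ^ 2 * W ^ 2 + 4 * Q * W ^ 3 - 2 * W ^ 4, by ring⟩
  obtain ⟨a, ha⟩ := d1
  obtain ⟨b, hb⟩ := d2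
  obtain ⟨c, hc⟩ := d3
  obtain ⟨d, hd⟩ := d4
  rw [hU, hU2, hR]
  refine ⟨a + X * b + R + X * c + d, ?_⟩
  linear_combination ha + X * hb + X * hc + hd - hQ

/-! ### Theta series and sums of two squares -/

/-- The integer square roots of `n`. -/
noncomputable def sqRoots (n : ℕ) : Finset ℤ := (Finset.Icc (-n : ℤ) n).filter fun x => x ^ 2 = n

/-- The representations of `n` as a sum of two integer squares. -/
noncomputable def twoSquares (n : ℕ) : Finset (ℤ × ℤ) :=
  (Finset.Icc (-n : ℤ) n ×ˢ Finset.Icc (-n : ℤ) n).filter fun p => p.1 ^ 2 + p.2 ^ 2 = n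

theorem mem_sqRoots {n : ℕ} {x : ℤ} : x ∈ sqRoots n ↔ x ^ 2 = n := by
  simp only [sqRoots, Finset.mem_filter, Finset.mem_Icc, and_iff_right_iff_imp]
  intro h
  constructor <;> nlinarith

theorem mem_twoSquares {n : ℕ} {p : ℤ × ℤ} : p ∈ twoSquares n ↔ p.1 ^ 2 + p.2 ^ 2 = n := by
  simp only [twoSquares, Finset.mem_filter, Finset.mem_product, Finset.mem_Icc,
    and_iff_right_iff_imp]
  intro h
  refine ⟨⟨?_, ?_⟩, ?_, ?_⟩ <;> nlinarith [sq_nonneg p.1, sq_nonneg p.2]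

/-- The theta series `∑ u x * X ^ (x ^ 2)`, summed over all integers `x`. -/
noncomputable def theta (u : ℤ → ℤ) : ℤ⟦X⟧ := PowerSeries.mk fun n => ∑ x ∈ sqRoots n, u x

@[simp] theorem coeff_theta (u : ℤ → ℤ) (n : ℕ) : coeff n (theta u) = ∑ x ∈ sqRoots n, u x :=
  coeff_mk _ _

theorem coeff_theta_mul (u v : ℤ → ℤ) (n : ℕ) :
    coeff n (theta u * theta v) = ∑ p ∈ twoSquares n, u p.1 * v p.2 := by
  rw [coeff_mul]
  have hmaps : ∀ p ∈ twoSquares n,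
      ((p.1 ^ 2).toNat, (p.2 ^ 2).toNat) ∈ Finset.HasAntidiagonal.antidiagonal n := by
    intro p hp
    rw [mem_twoSquares] at hp
    rw [Finset.HasAntidiagonal.mem_antidiagonal]
    have := sq_nonneg p.1
    have := sq_nonneg p.2
    omega
  rw [← Finset.sum_fiberwise_of_maps_to hmaps]
  refine Finset.sum_congr rfl fun ij hij => ?_
  rw [Finset.HasAntidiagonal.mem_antidiagonal] at hij
  rw [coeff_theta, coeff_theta, Finset.sum_mul_sum, ← Finset.sum_product']
  refine Finset.sum_congr ?_ fun _ _ => rfl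
  ext p
  rw [Finset.mem_product, mem_sqRoots, mem_sqRoots, Finset.mem_filter, mem_twoSquares,
    Prod.ext_iff]
  have := sq_nonneg p.1
  have := sq_nonneg p.2
  dsimp only
  omega

theorem sum_twoSquares_swap (f : ℤ → ℤ → ℤ) (n : ℕ) :
    ∑ p ∈ twoSquares n, f p.1 p.2 = ∑ p ∈ twoSquares n, f p.2 p.1 := by
  refine Finset.sum_nbij' Prod.swap Prod.swap ?_ ?_ ?_ ?_ ?_ <;>
    simp [mem_twoSquares, add_comm]

theorem sum_twoSquares_neg (f : ℤ → ℤ → ℤ) (n : ℕ) :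
    ∑ p ∈ twoSquares n, f p.1 p.2 = ∑ p ∈ twoSquares n, f p.1 (-p.2) := by
  refine Finset.sum_nbij' (fun p => (p.1, -p.2)) (fun p => (p.1, -p.2)) ?_ ?_ ?_ ?_ ?_ <;>
    simp [mem_twoSquares]

/-- This is multiplication by `1 + i` up to a unit and conjugation: an even `x ^ 2 + y ^ 2` forces
`x` and `y` to have the same parity, so the map can be inverted. -/
theorem sum_twoSquares_two_mul (f : ℤ → ℤ → ℤ) (n : ℕ) :
    ∑ p ∈ twoSquares (2 * n), f p.1 p.2 =
      ∑ p ∈ twoSquares n, f (p.1 + p.2) (p.1 - p.2) := by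
  symm
  refine Finset.sum_nbij' (fun p => (p.1 + p.2, p.1 - p.2))
    (fun p => ((p.1 + p.2) / 2, (p.1 - p.2) / 2)) ?_ ?_ ?_ ?_ ?_
  · intro p hp
    rw [mem_twoSquares] at hp ⊢
    push_cast
    linear_combination 2 * hp
  · rintro ⟨x, y⟩ hp
    rw [mem_twoSquares] at hp ⊢
    dsimp only at hp ⊢
    push_cast at hp
    have hpar : Even (x + y) := by
      have h : Even (x ^ 2 + y ^ 2) := hp ▸ even_two_mul _
      simpa [Int.even_add, Int.even_pow] using h
    obtain ⟨a, ha⟩ := hpar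
    obtain rfl : y = a + a - x := by omega
    rw [show (x + (a + a - x)) / 2 = a by omega, show (x - (a + a - x)) / 2 = x - a by omega]
    linarith
  · rintro ⟨a, b⟩ -
    ext <;> dsimp only <;> omega
  · rintro ⟨x, y⟩ hp
    rw [mem_twoSquares] at hp
    dsimp only at hp ⊢
    push_cast at hp
    have hpar : Even (x + y) := by
      have h : Even (x ^ 2 + y ^ 2) := hp ▸ even_two_mul _
      simpa [Int.even_add, Int.even_pow] using h
    obtain ⟨a, ha⟩ := hpar
    ext <;> dsimp only <;> omega
  · intro p _
    rfl

theorem coeff_theta_eq_zero {u : ℤ → ℤ} {n : ℕ} (h : ∀ x : ℤ, x ^ 2 = n → u x = 0) :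
    coeff n (theta u) = 0 := by
  rw [coeff_theta]
  exact Finset.sum_eq_zero fun x hx => h x (mem_sqRoots.1 hx)

/-- The roots `x` and `-x` pair off, and the unpaired root `0` has weight zero. -/
theorem two_dvd_theta {u : ℤ → ℤ} (hu : ∀ x, u (-x) = u x) (h0 : u 0 = 0) :
    (2 : ℤ⟦X⟧) ∣ theta u := by
  have h := (natCast_dvd_iff_coeff 2 (theta u)).2
  rw [Nat.cast_ofNat] at h
  apply h
  intro n
  rw [coeff_theta]
  by_cases hn : ∃ x : ℤ, x ^ 2 = n
  · obtain ⟨x, hx⟩ := hn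
    have hs : sqRoots n = {x, -x} := by
      ext y
      rw [mem_sqRoots, ← hx, sq_eq_sq_iff_eq_or_eq_neg]
      simp
    rw [hs]
    by_cases hx0 : x = 0
    · simp [hx0, h0]
    · rw [Finset.sum_pair (by omega), hu]
      exact ⟨u x, by ring⟩
  · rw [Finset.sum_eq_zero]
    · exact dvd_zero _
    · intro x hx
      exact absurd ⟨x, mem_sqRoots.1 hx⟩ hn

theorem theta_add (u v : ℤ → ℤ) : theta (u + v) = theta u + theta v := by
  ext n
  simp [Finset.sum_add_distrib]

theorem theta_delta : theta (fun x => if x = 0 then 1 else 0) = 1 := by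
  ext n
  rw [coeff_theta, coeff_one]
  split_ifs with hn
  · subst hn
    have : sqRoots 0 = {0} := by ext x; simp [mem_sqRoots]
    simp [this]
  · refine Finset.sum_eq_zero fun x hx => ?_
    rw [mem_sqRoots] at hx
    rw [if_neg]
    rintro rfl
    simp at hx
    omega

theorem exists_theta_eq_one_add {u : ℤ → ℤ} (hu : ∀ x, u (-x) = u x) (h0 : u 0 = 1) :
    ∃ F, theta u = 1 + 2 * F := by
  obtain ⟨F, hF⟩ := two_dvd_theta (u := u - fun x => if x = 0 then 1 else 0)
    (fun x => by simp [hu]) (by simp [h0])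
  refine ⟨F, ?_⟩
  rw [← hF, ← theta_delta, ← theta_add]
  simp

/-! ### Theta identities giving the dissection of `G` -/

/-- The values `ω ^ x + ω ^ (-x)` for a primitive cube root of unity `ω`. -/
def cubicTrace (x : ℤ) : ℤ := if 3 ∣ x then 2 else -1

theorem cubicTrace_add_add_sub (a b : ℤ) :
    cubicTrace (a + b) + cubicTrace (a - b) = cubicTrace a * cubicTrace b := by
  unfold cubicTrace
  obtain h | h | h : a % 3 = 0 ∨ a % 3 = 1 ∨ a % 3 = 2 := by omega
  all_goals split_ifs <;> omega

/-- The left side becomes a sum of `cubicTrace (a + b)`; averaging over `b ↦ -b` turns it into a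
product of traces. -/
theorem evenPart_cubicTrace_mul :
    2 * evenPart (theta cubicTrace * theta 1) = theta cubicTrace ^ 2 := by
  ext n
  rw [two_mul, map_add, coeff_evenPart, coeff_theta_mul, sq, coeff_theta_mul,
    sum_twoSquares_two_mul fun x y => cubicTrace x * (1 : ℤ → ℤ) y]
  nth_rw 2 [sum_twoSquares_neg fun x y => cubicTrace (x + y) * (1 : ℤ → ℤ) (x - y)]
  rw [← Finset.sum_add_distrib]
  refine Finset.sum_congr rfl fun p _ => ?_
  rw [← cubicTrace_add_add_sub, ← sub_eq_add_neg]
  simp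

/-- The sign `(-1) ^ x`. -/
def parity (x : ℤ) : ℤ := if 2 ∣ x then 1 else -1

theorem evenPart_parity_mul : evenPart (theta parity * theta 1) = theta parity ^ 2 := by
  ext n
  rw [coeff_evenPart, coeff_theta_mul, sq, coeff_theta_mul,
    sum_twoSquares_two_mul fun x y => parity x * (1 : ℤ → ℤ) y]
  refine Finset.sum_congr rfl fun p _ => ?_
  simp only [parity, Pi.one_apply]
  split_ifs <;> omega

theorem twoSquares_odd {n : ℕ} {p : ℤ × ℤ} (hp : p ∈ twoSquares (2 * n + 1)) :
    2 ∣ p.1 ↔ ¬ 2 ∣ p.2 := by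
  rw [mem_twoSquares] at hp
  have h : Odd (p.1 ^ 2 + p.2 ^ 2) := ⟨n, by rw [hp]; push_cast; ring⟩
  rw [← even_iff_two_dvd, ← even_iff_two_dvd]
  have := Int.odd_add'.1 h
  simp only [Int.odd_pow, Int.even_pow, ne_eq, OfNat.ofNat_ne_zero, not_false_eq_true, and_true,
    or_false] at this
  rw [← Int.not_even_iff_odd] at this
  tauto

/-- When `x ^ 2 + y ^ 2` is odd, `x` and `y` have opposite parities, so swapping them changes the
sign of the sum. -/
theorem oddPart_parity_mul : oddPart (theta parity * theta 1) = 0 := by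
  ext n
  rw [coeff_oddPart, coeff_theta_mul, map_zero]
  have h := sum_twoSquares_swap (fun x y => parity x * (1 : ℤ → ℤ) y) (2 * n + 1)
  have h2 : ∑ p ∈ twoSquares (2 * n + 1), parity p.2 * (1 : ℤ → ℤ) p.1 =
      - ∑ p ∈ twoSquares (2 * n + 1), parity p.1 * (1 : ℤ → ℤ) p.2 := by
    rw [← Finset.sum_neg_distrib]
    refine Finset.sum_congr rfl fun p hp => ?_
    have := twoSquares_odd hp
    simp only [parity, Pi.one_apply]
    split_ifs <;> omega
  linarith

/-- The indicator of the multiples of `3`. -/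
def threeDvd (x : ℤ) : ℤ := if 3 ∣ x then 1 else 0

/-- The indicator of the integers not divisible by `3`. -/
def notThreeDvd (x : ℤ) : ℤ := if 3 ∣ x then 0 else 1

/-- The indicator of the integers coprime to `6`. -/
def coprimeSix (x : ℤ) : ℤ := if 2 ∣ x ∨ 3 ∣ x then 0 else 1

theorem coeff_theta_coprimeSix {n : ℕ} (hn : n % 8 ≠ 1) : coeff n (theta coprimeSix) = 0 := by
  refine coeff_theta_eq_zero fun x hx => ?_
  unfold coprimeSix
  rw [if_pos]
  by_contra! h
  have h2 := Int.eight_dvd_sq_sub_one_of_odd (k := x) (by rw [Int.odd_iff]; omega)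
  omega

/-- For `a`, `b` of opposite parity, `a + b` and `a - b` are odd, and both are prime to 3 exactly
when 3 divides just one of `a`, `b`. -/
theorem sum_threeDvd (n : ℕ) :
    coeff (2 * (2 * n + 1)) (theta coprimeSix ^ 2) =
      2 * coeff (2 * n + 1) (theta threeDvd * theta notThreeDvd) := by
  rw [sq, coeff_theta_mul, coeff_theta_mul,
    sum_twoSquares_two_mul fun x y => coprimeSix x * coprimeSix y,
    two_mul (∑ p ∈ twoSquares (2 * n + 1), _)]
  nth_rw 2 [sum_twoSquares_swap fun x y => threeDvd x * notThreeDvd y]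
  rw [← Finset.sum_add_distrib]
  refine Finset.sum_congr rfl fun p hp => ?_
  have := twoSquares_odd hp
  unfold coprimeSix threeDvd notThreeDvd
  obtain h | h | h : p.1 % 3 = 0 ∨ p.1 % 3 = 1 ∨ p.1 % 3 = 2 := by omega
  all_goals
    obtain h' | h' | h' : p.2 % 3 = 0 ∨ p.2 % 3 = 1 ∨ p.2 % 3 = 2 := by omega
  all_goals split_ifs <;> omega

theorem exists_oddPart_threeDvd_mul :
    ∃ K, oddPart K = 0 ∧ oddPart (theta threeDvd * theta notThreeDvd) = 2 * K ^ 2 := by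
  obtain ⟨F, hF⟩ := two_dvd_theta (u := coprimeSix)
    (fun x => by simp [coprimeSix]) (by simp [coprimeSix])
  -- Squares of odd integers are 1 modulo 8, so `F = q f(q^8)`; the witness `K` is then `f(q^2)`.
  have hc : ∀ n, n % 8 ≠ 1 → coeff n F = 0 := by
    intro n hn
    have h := coeff_theta_coprimeSix hn
    rw [hF, two_mul, map_add] at h
    omega
  have h1 : evenPart F = 0 := by
    ext n
    rw [coeff_evenPart, hc _ (by omega), map_zero]
  have h2 : oddPart (oddPart F) = 0 := by
    ext n
    rw [coeff_oddPart, coeff_oddPart, hc _ (by omega), map_zero]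
  refine ⟨evenPart (oddPart F), ?_, ?_⟩
  · ext n
    rw [coeff_oddPart, coeff_evenPart, coeff_oddPart, hc _ (by omega), map_zero]
  · have h3 : evenPart (F ^ 2) = X * oddPart F ^ 2 := by rw [evenPart_sq, h1]; ring
    have h4 : oddPart (evenPart (F ^ 2)) = evenPart (oddPart F) ^ 2 := by
      rw [h3, oddPart_X_mul, evenPart_sq, h2]; ring
    rw [← h4]
    ext n
    have h5 := sum_threeDvd n
    rw [hF, show (2 * F) ^ 2 = ((4 : ℕ) : ℤ⟦X⟧) * F ^ 2 by push_cast; ring,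
      ← map_natCast (C (R := ℤ)), coeff_C_mul] at h5
    rw [two_mul, map_add, coeff_oddPart, coeff_oddPart, coeff_evenPart]
    push_cast at h5
    linarith

theorem natCast_ne_zero {m : ℕ} (hm : m ≠ 0) : (m : ℤ⟦X⟧) ≠ 0 := by
  rw [← map_natCast (C (R := ℤ)), ne_eq, map_eq_zero_iff _ C_injective]
  exact_mod_cast hm

/-- The dissection of the power series `G` whose product with `2 * ∑ (-1) ^ x * X ^ (x ^ 2)` is
`∑ cubicTrace x * X ^ (x ^ 2)`. -/
theorem dissection_of_theta {G : ℤ⟦X⟧} (hG : 2 * G * theta parity = theta cubicTrace) :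
    evenPart G = G ^ 2 ∧ ∃ K L, oddPart G = K ^ 2 + 4 * L ∧ oddPart K = 0 := by
  have e2 : ∀ F : ℤ⟦X⟧, evenPart (2 * F) = 2 * evenPart F := fun F => evenPart_natCast_mul 2 F
  have o2 : ∀ F : ℤ⟦X⟧, oddPart (2 * F) = 2 * oddPart F := fun F => oddPart_natCast_mul 2 F
  have o4 : ∀ F : ℤ⟦X⟧, oddPart (4 * F) = 4 * oddPart F := fun F => oddPart_natCast_mul 4 F
  have hE := evenPart_parity_mul
  have hO := oddPart_parity_mul
  obtain ⟨P, hP⟩ := exists_theta_eq_one_add (u := parity) (fun x => by simp [parity]) rfl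
  have hψ : theta parity ≠ 0 := by
    intro h
    have h2 := congrArg constantCoeff (h ▸ hP)
    rw [map_zero, map_add, map_one, map_mul, map_ofNat] at h2
    omega
  have hprod : 2 * (G * (theta parity * theta 1)) = theta cubicTrace * theta 1 := by
    rw [← hG]; ring
  constructor
  · have h := evenPart_cubicTrace_mul
    rw [← hprod, e2, evenPart_mul, hE, hO, ← hG] at h
    have h4 : (4 : ℤ⟦X⟧) * theta parity ^ 2 ≠ 0 :=
      mul_ne_zero (natCast_ne_zero (m := 4) (by norm_num)) (pow_ne_zero _ hψ)
    apply mul_left_cancel₀ h4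
    linear_combination h
  · obtain ⟨K, hK, hK2⟩ := exists_oddPart_threeDvd_mul
    obtain ⟨A, hA⟩ := exists_theta_eq_one_add (u := threeDvd) (fun x => by simp [threeDvd]) rfl
    obtain ⟨B, hB⟩ := two_dvd_theta (u := notThreeDvd) (fun x => by simp [notThreeDvd]) rfl
    have hφ : theta 1 = theta threeDvd + theta notThreeDvd := by
      rw [← theta_add]
      congr 1
      ext x
      simp only [Pi.add_apply, threeDvd, notThreeDvd, Pi.one_apply]
      split_ifs <;> rfl
    have hT : theta cubicTrace + theta notThreeDvd = 2 * theta threeDvd := by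
      rw [two_mul, ← theta_add, ← theta_add]
      congr 1
      ext x
      simp only [Pi.add_apply, threeDvd, notThreeDvd, cubicTrace]
      split_ifs <;> rfl
    -- With `a = theta threeDvd = 1 + 2 * A` and `b = theta notThreeDvd = 2 * B`, this is `(2a -
    -- b)(a + b) = 2a^2 + ab - b^2`. Only `ab` matters for the odd part modulo 8.
    have h : theta cubicTrace * theta 1 = 2 + theta threeDvd * theta notThreeDvd
        + 4 * (2 * (A + A ^ 2)) - 4 * B ^ 2 := by
      rw [hφ, eq_sub_of_add_eq hT, hA, hB]; ring
    have h' := congrArg oddPart (hprod.trans h)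
    have o0 : oddPart (2 : ℤ⟦X⟧) = 0 := oddPart_natCast 2
    rw [o2, oddPart_mul, hO, hE, oddPart_sub, oddPart_add, oddPart_add, o4, o4, o2, oddPart_sq,
      hK2, o0, hP] at h'
    refine ⟨K, oddPart (A + A ^ 2) - evenPart B * oddPart B - oddPart G * (P + P ^ 2), ?_, hK⟩
    have h2 : (2 : ℤ⟦X⟧) ≠ 0 := natCast_ne_zero (m := 2) (by norm_num)
    apply mul_left_cancel₀ h2
    linear_combination h'

/-! ### The finite Jacobi triple product -/

/-- The finite product `(1 - X ^ 2) (1 - X ^ 4) ⋯ (1 - X ^ (2 * n))`. -/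
noncomputable def evenFactorial (n : ℕ) : ℤ⟦X⟧ := ∏ i ∈ Finset.range n, (1 - X ^ (2 * (i + 1)))

/-- The inverse of `evenFactorial n`, extended by zero to negative `n`. -/
noncomputable def invEvenFactorial (n : ℤ) : ℤ⟦X⟧ :=
  if 0 ≤ n then invOfUnit (evenFactorial n.toNat) 1 else 0

theorem constantCoeff_evenFactorial (n : ℕ) : constantCoeff (evenFactorial n) = 1 := by
  simp [evenFactorial, map_prod]

theorem evenFactorial_mul_inv (n : ℕ) : evenFactorial n * invEvenFactorial n = 1 := by
  rw [invEvenFactorial, if_pos (by positivity), Int.toNat_natCast]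
  exact mul_invOfUnit _ _ (by simp [constantCoeff_evenFactorial])

theorem evenFactorial_ne_zero (n : ℕ) : evenFactorial n ≠ 0 := by
  intro h
  have := constantCoeff_evenFactorial n
  simp [h] at this

theorem evenFactorial_succ (n : ℕ) :
    evenFactorial (n + 1) = evenFactorial n * (1 - X ^ (2 * (n + 1))) :=
  Finset.prod_range_succ _ _

theorem invEvenFactorial_of_neg {n : ℤ} (hn : n < 0) : invEvenFactorial n = 0 :=
  if_neg (by omega)

/-- The case `n = 0` survives because the extension by zero matches `1 - X ^ 0 = 0`. -/
theorem invEvenFactorial_sub_one (n : ℕ) :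
    invEvenFactorial (n - 1 : ℤ) = (1 - X ^ (2 * n)) * invEvenFactorial n := by
  rcases n with _ | n
  · simp [invEvenFactorial_of_neg]
  · have h1 := evenFactorial_mul_inv n
    have h2 := evenFactorial_mul_inv (n + 1)
    rw [evenFactorial_succ] at h2
    rw [Nat.cast_add_one] at h2 ⊢
    rw [add_sub_cancel_right]
    apply mul_left_cancel₀ (evenFactorial_ne_zero n)
    rw [h1, ← mul_assoc, h2]

/-- The coefficients `[2 * n, n + k]` of the finite Jacobi triple product, up to the factor
`evenFactorial (2 * n)`. -/
noncomputable def jacobiCoeff (n : ℕ) (k : ℤ) : ℤ⟦X⟧ :=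
  invEvenFactorial (n + k) * invEvenFactorial (n - k)

theorem jacobiCoeff_of_lt {n : ℕ} {k : ℤ} (h : n < |k|) : jacobiCoeff n k = 0 := by
  rw [jacobiCoeff]
  rcases lt_abs.1 h with h | h
  · rw [invEvenFactorial_of_neg (n := n - k) (by omega), mul_zero]
  · rw [invEvenFactorial_of_neg (n := n + k) (by omega), zero_mul]

/-- The recurrence for the terms of the finite Jacobi triple product. -/
theorem jacobiCoeff_succ (n : ℕ) (k : ℤ) :
    (1 - X ^ (4 * n + 2)) * (1 - X ^ (4 * n + 4)) *
        (jacobiCoeff (n + 1) k * X ^ (k.natAbs ^ 2)) =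
      (1 + X ^ (4 * n + 2)) * (jacobiCoeff n k * X ^ (k.natAbs ^ 2)) +
        X ^ (2 * n + 1) * (jacobiCoeff n (k - 1) * X ^ ((k - 1).natAbs ^ 2) +
          jacobiCoeff n (k + 1) * X ^ ((k + 1).natAbs ^ 2)) := by
  rcases lt_or_ge ((n : ℤ) + 1) |k| with h | h
  · rw [jacobiCoeff_of_lt (n := n + 1) (by push_cast; exact h), jacobiCoeff_of_lt (by omega),
      jacobiCoeff_of_lt, jacobiCoeff_of_lt]
    · ring
    all_goals rcases abs_cases k with ⟨h1, -⟩ | ⟨h1, -⟩ <;> grind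
  · obtain ⟨h1, h2⟩ := abs_le.1 h
    have hr : ∀ m : ℕ, invEvenFactorial m = (1 - X ^ (2 * m + 2)) * invEvenFactorial (m + 1) := by
      intro m
      simpa [mul_add] using invEvenFactorial_sub_one (m + 1)
    have hneg := fun {m : ℤ} => invEvenFactorial_of_neg (n := m)
    -- At the edges `k = -(n + 1)` and `k = n + 1` only one term on the right is nonzero.
    rcases eq_or_lt_of_le h1 with hk | hk
    · have h3 := hr (2 * n)
      have h4 := hr (2 * n + 1)
      push_cast at h3 h4
      rw [show (2 * n + 1 + 1 : ℤ) = 2 * n + 2 by ring] at h4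
      simp only [jacobiCoeff, ← hk]
      push_cast
      rw [hneg (m := n + (-(n + 1))) (by omega), hneg (m := n + (-(n + 1) - 1)) (by omega),
        show (n + 1 + -(n + 1) : ℤ) = 0 by ring, show (n + 1 - -(n + 1) : ℤ) = 2 * n + 2 by ring,
        show (n + (-(n + 1) + 1) : ℤ) = 0 by ring, show (n - (-(n + 1) + 1) : ℤ) = 2 * n by ring,
        show (-(n + 1) : ℤ).natAbs = n + 1 by omega,
        show (-(n + 1) + 1 : ℤ).natAbs = n by omega, h3, h4]
      ring
    rcases eq_or_lt_of_le h2 with hk' | hk'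
    · have h3 := hr (2 * n)
      have h4 := hr (2 * n + 1)
      push_cast at h3 h4
      rw [show (2 * n + 1 + 1 : ℤ) = 2 * n + 2 by ring] at h4
      simp only [jacobiCoeff, hk']
      push_cast
      rw [hneg (m := n - (n + 1)) (by omega), hneg (m := n - (n + 1 + 1)) (by omega),
        show (n + 1 - (n + 1) : ℤ) = 0 by ring, show (n + 1 + (n + 1) : ℤ) = 2 * n + 2 by ring,
        show (n + ((n + 1) - 1) : ℤ) = 2 * n by ring, show (n - ((n + 1) - 1) : ℤ) = 0 by ring,
        show ((n + 1 : ℤ)).natAbs = n + 1 by omega,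
        show ((n + 1) - 1 : ℤ).natAbs = n by omega, h3, h4]
      ring
    obtain ⟨a, ha⟩ := Int.eq_ofNat_of_zero_le (show 0 ≤ (n : ℤ) + k by omega)
    obtain ⟨b, hb⟩ := Int.eq_ofNat_of_zero_le (show 0 ≤ (n : ℤ) - k by omega)
    have hn : 4 * n = 2 * a + 2 * b := by omega
    have e1 : 2 * n + 1 + (k - 1).natAbs ^ 2 = k.natAbs ^ 2 + (2 * b + 2) := by
      zify
      rw [sq_abs, sq_abs]
      linear_combination 2 * hb
    have e2 : 2 * n + 1 + (k + 1).natAbs ^ 2 = k.natAbs ^ 2 + (2 * a + 2) := by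
      zify
      rw [sq_abs, sq_abs]
      linear_combination 2 * ha
    have e3 : ∀ A B : ℤ⟦X⟧, X ^ (2 * n + 1) * (A * X ^ ((k - 1).natAbs ^ 2) +
        B * X ^ ((k + 1).natAbs ^ 2)) =
          X ^ (k.natAbs ^ 2) * (X ^ (2 * b + 2) * A + X ^ (2 * a + 2) * B) := by
      intro A B
      rw [mul_add, mul_left_comm, ← pow_add, e1, mul_left_comm, ← pow_add, e2]
      ring
    rw [e3]
    simp only [jacobiCoeff]
    push_cast
    rw [show (n + 1 + k : ℤ) = a + 1 by omega, show (n + 1 - k : ℤ) = b + 1 by omega, ha, hb,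
      show (n + (k - 1) : ℤ) = a - 1 by omega, show (n - (k - 1) : ℤ) = b + 1 by omega,
      show (n + (k + 1) : ℤ) = a + 1 by omega, show (n - (k + 1) : ℤ) = b - 1 by omega,
      invEvenFactorial_sub_one, invEvenFactorial_sub_one, hn]
    simp only [hr]
    ring

theorem finite_support_jacobiCoeff (n : ℕ) (f : ℤ → ℤ⟦X⟧) :
    (Function.support fun k => jacobiCoeff n k * f k).Finite := by
  refine (Set.finite_Icc (-n : ℤ) n).subset fun k hk => ?_
  rw [Set.mem_Icc, ← abs_le]
  by_contra h
  exact hk (by simp only [jacobiCoeff_of_lt (not_le.1 h), zero_mul])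

/-- The finite Jacobi triple product, with `z ^ k` replaced by a solution `w k` of the recurrence
`w (k + 1) + w (k - 1) = t * w k`. -/
theorem finite_jacobi_triple_product {w : ℤ → ℤ} {t : ℤ}
    (hw : ∀ k, w (k + 1) + w (k - 1) = t * w k) (n : ℕ) :
    evenFactorial (2 * n) * ∑ᶠ k, jacobiCoeff n k * (X ^ (k.natAbs ^ 2) * C (w k)) =
      C (w 0) * ∏ i ∈ Finset.range n, (1 + C t * X ^ (2 * i + 1) + X ^ (4 * i + 2)) := by
  induction n with
  | zero =>
    rw [finsum_eq_single _ 0]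
    · have := evenFactorial_mul_inv 0
      simp only [evenFactorial, Finset.range_zero, Finset.prod_empty, one_mul,
        Nat.cast_zero] at this
      simp [jacobiCoeff, this, evenFactorial]
    · intro k hk
      rw [jacobiCoeff_of_lt (by simpa using hk), zero_mul]
  | succ n ih =>
    rw [Finset.prod_range_succ, ← mul_assoc, ← ih, show 2 * (n + 1) = 2 * n + 1 + 1 by ring,
      evenFactorial_succ, evenFactorial_succ, mul_assoc, mul_assoc, mul_assoc]
    congr 1
    have hs := finite_support_jacobiCoeff
    have s1 : ∑ᶠ k, jacobiCoeff n (k - 1) * (X ^ ((k - 1).natAbs ^ 2) * C (w k)) =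
        ∑ᶠ k, jacobiCoeff n k * (X ^ (k.natAbs ^ 2) * C (w (k + 1))) := by
      rw [← finsum_comp_equiv (Equiv.subRight (1 : ℤ))
        (f := fun k => jacobiCoeff n k * (X ^ (k.natAbs ^ 2) * C (w (k + 1))))]
      simp
    have s2 : ∑ᶠ k, jacobiCoeff n (k + 1) * (X ^ ((k + 1).natAbs ^ 2) * C (w k)) =
        ∑ᶠ k, jacobiCoeff n k * (X ^ (k.natAbs ^ 2) * C (w (k - 1))) := by
      rw [← finsum_comp_equiv (Equiv.addRight (1 : ℤ))
        (f := fun k => jacobiCoeff n k * (X ^ (k.natAbs ^ 2) * C (w (k - 1))))]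
      simp
    have t1 : (Function.support fun k =>
        jacobiCoeff n (k - 1) * (X ^ ((k - 1).natAbs ^ 2) * C (w k))).Finite := by
      refine ((hs n fun _ => 1).preimage (f := fun k => k - 1)
        (fun a _ b _ h => by simpa using h)).subset fun k hk => ?_
      simpa using left_ne_zero_of_mul hk
    have t2 : (Function.support fun k =>
        jacobiCoeff n (k + 1) * (X ^ ((k + 1).natAbs ^ 2) * C (w k))).Finite := by
      refine ((hs n fun _ => 1).preimage (f := fun k => k + 1)
        (fun a _ b _ h => by simpa using h)).subset fun k hk => ?_
      simpa using left_ne_zero_of_mul hk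
    have fin_mul : ∀ (c : ℤ⟦X⟧) {f : ℤ → ℤ⟦X⟧}, (Function.support f).Finite →
        (Function.support fun k => c * f k).Finite := fun c f hf =>
      hf.subset fun k hk => right_ne_zero_of_mul hk
    have fin_add : ∀ {f g : ℤ → ℤ⟦X⟧}, (Function.support f).Finite → (Function.support g).Finite →
        (Function.support fun k => f k + g k).Finite := fun hf hg =>
      (hf.union hg).subset (Function.support_add _ _)
    -- After the index shifts, the recurrence of `w` replaces the two neighbours by multiplication
    -- by `t`.
    have hx : (∑ᶠ k, jacobiCoeff n k * (X ^ (k.natAbs ^ 2) * C (w (k + 1)))) +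
        ∑ᶠ k, jacobiCoeff n k * (X ^ (k.natAbs ^ 2) * C (w (k - 1))) =
          C t * ∑ᶠ k, jacobiCoeff n k * (X ^ (k.natAbs ^ 2) * C (w k)) := by
      rw [← finsum_add_distrib (hs n _) (hs n _), mul_finsum]
      refine finsum_congr fun k => ?_
      rw [← mul_add, ← mul_add, ← map_add, hw, map_mul]
      ring
    rw [← mul_assoc, mul_finsum]
    calc _ = ∑ᶠ k, ((1 + X ^ (4 * n + 2)) *
            (jacobiCoeff n k * (X ^ (k.natAbs ^ 2) * C (w k))) + X ^ (2 * n + 1) *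
            (jacobiCoeff n (k - 1) * (X ^ ((k - 1).natAbs ^ 2) * C (w k)) +
            jacobiCoeff n (k + 1) * (X ^ ((k + 1).natAbs ^ 2) * C (w k)))) := by
          refine finsum_congr fun k => ?_
          have := jacobiCoeff_succ n k
          rw [show 2 * (2 * n + 1) = 4 * n + 2 by ring,
            show 2 * (2 * n + 1 + 1) = 4 * n + 4 by ring]
          linear_combination C (w k) * this
      _ = _ := by
          rw [finsum_add_distrib (fin_mul _ (hs _ _)) (fin_mul _ (fin_add t1 t2)),
            ← mul_finsum, ← mul_finsum,
            finsum_add_distrib t1 t2, s1, s2, hx]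
          ring

/-! ### Passage to the limit in the triple product -/

theorem X_pow_dvd_evenFactorial_sub {m n : ℕ} (h : m ≤ n) :
    (X : ℤ⟦X⟧) ^ (2 * m + 2) ∣ evenFactorial n - evenFactorial m := by
  induction n, h using Nat.le_induction with
  | base => simp
  | succ n hn ih =>
    rw [evenFactorial_succ, mul_sub, mul_one, sub_right_comm]
    exact dvd_sub ih ((pow_dvd_pow _ (by omega)).mul_left _)

theorem X_pow_dvd_evenFactorial_mul_inv_sub_one {m n d : ℕ} (hm : d ≤ m) (hn : d ≤ n) :
    (X : ℤ⟦X⟧) ^ (2 * d + 2) ∣ evenFactorial n * invEvenFactorial m - 1 := by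
  rw [← evenFactorial_mul_inv m, ← sub_mul, ← sub_sub_sub_cancel_right _ _ (evenFactorial d)]
  exact (dvd_sub (X_pow_dvd_evenFactorial_sub hn) (X_pow_dvd_evenFactorial_sub hm)).mul_right _

theorem X_pow_dvd_jacobiCoeff_sub {n : ℕ} {k : ℤ} (hk : |k| ≤ n) :
    (X : ℤ⟦X⟧) ^ (n + 1) ∣
      evenFactorial n ^ 2 * (jacobiCoeff n k * X ^ (k.natAbs ^ 2)) - X ^ (k.natAbs ^ 2) := by
  obtain ⟨h1, h2⟩ := abs_le.1 hk
  obtain ⟨a, ha⟩ := Int.eq_ofNat_of_zero_le (show 0 ≤ (n : ℤ) + k by omega)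
  obtain ⟨b, hb⟩ := Int.eq_ofNat_of_zero_le (show 0 ≤ (n : ℤ) - k by omega)
  rw [jacobiCoeff, ha, hb]
  have hA := X_pow_dvd_evenFactorial_mul_inv_sub_one (m := a) (n := n) (d := n - k.natAbs)
    (by omega) (by omega)
  have hB := X_pow_dvd_evenFactorial_mul_inv_sub_one (m := b) (n := n) (d := n - k.natAbs)
    (by omega) (by omega)
  have hAB := dvd_add (hA.mul_right (evenFactorial n * invEvenFactorial b)) hB
  -- The approximation weakens as `|k|` grows, but the factor `X ^ (k ^ 2)` makes up for the loss.
  have hle : n + 1 ≤ k.natAbs ^ 2 + (2 * (n - k.natAbs) + 2) := by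
    obtain ⟨c, hc⟩ : ∃ c, n = k.natAbs + c := ⟨n - k.natAbs, by omega⟩
    rw [hc, Nat.add_sub_cancel_left]
    nlinarith [Nat.le_self_pow two_ne_zero k.natAbs]
  refine (pow_dvd_pow _ hle).trans ?_
  rw [pow_add]
  refine (mul_dvd_mul_left _ hAB).trans (dvd_of_eq ?_)
  ring

theorem X_pow_dvd_sum_sub_theta (w : ℤ → ℤ) (n : ℕ) :
    (X : ℤ⟦X⟧) ^ (n + 1) ∣
      ∑ k ∈ Finset.Icc (-n : ℤ) n, X ^ (k.natAbs ^ 2) * C (w k) - theta w := by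
  rw [X_pow_dvd_iff]
  intro m hm
  rw [map_sub, sub_eq_zero, map_sum, coeff_theta]
  simp only [coeff_mul_C, coeff_X_pow, ite_mul, one_mul, zero_mul]
  rw [← Finset.sum_filter]
  refine Finset.sum_congr ?_ fun _ _ => rfl
  ext k
  rw [Finset.mem_filter, mem_sqRoots, Finset.mem_Icc]
  zify
  rw [sq_abs, eq_comm (a := (m : ℤ)), and_iff_right_iff_imp]
  intro h
  constructor <;> nlinarith

theorem X_pow_dvd_finsum_sub_theta (w : ℤ → ℤ) (n : ℕ) :
    (X : ℤ⟦X⟧) ^ (n + 1) ∣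
      evenFactorial n ^ 2 * ∑ᶠ k, jacobiCoeff n k * (X ^ (k.natAbs ^ 2) * C (w k)) - theta w := by
  rw [finsum_eq_sum_of_support_subset (s := Finset.Icc (-n : ℤ) n)]
  · rw [← sub_add_sub_cancel _ (∑ k ∈ Finset.Icc (-n : ℤ) n, X ^ (k.natAbs ^ 2) * C (w k))]
    refine dvd_add ?_ (X_pow_dvd_sum_sub_theta w n)
    rw [Finset.mul_sum, ← Finset.sum_sub_distrib]
    refine Finset.dvd_sum fun k hk => ?_
    rw [Finset.mem_Icc, ← abs_le] at hk
    refine ((X_pow_dvd_jacobiCoeff_sub hk).mul_right (C (w k))).trans (dvd_of_eq ?_)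
    ring
  · intro k hk
    rw [Finset.coe_Icc, Set.mem_Icc, ← abs_le]
    by_contra h
    exact hk (by simp only [jacobiCoeff_of_lt (not_le.1 h), zero_mul])

/-- A power series that agrees to any order with the quotients of the products
`∏ (1 - X ^ (2 * i + 1) + X ^ (4 * i + 2))` and `∏ (1 - X ^ (2 * i + 1)) ^ 2` is a quotient of
theta series. -/
theorem two_mul_mul_theta_parity {G : ℤ⟦X⟧}
    (hG : ∀ n : ℕ, ∃ m, n ≤ m ∧ X ^ (n + 1) ∣
      G * ∏ i ∈ Finset.range m, (1 - X ^ (2 * i + 1)) ^ 2 -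
        ∏ i ∈ Finset.range m, (1 - X ^ (2 * i + 1) + X ^ (4 * i + 2))) :
    2 * G * theta parity = theta cubicTrace := by
  rw [← sub_eq_zero]
  ext n
  obtain ⟨m, hnm, hm⟩ := hG n
  -- Here `t = ω + ω⁻¹ = -1`; for `parity`, `z = -1` gives `t = -2`.
  have hw : ∀ k, cubicTrace (k + 1) + cubicTrace (k - 1) = -1 * cubicTrace k := by
    intro k
    rw [cubicTrace_add_add_sub, mul_comm]
    rfl
  have hs : ∀ k, parity (k + 1) + parity (k - 1) = -2 * parity k := by
    intro k
    unfold parity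
    split_ifs <;> omega
  have h1 := finite_jacobi_triple_product hw m
  have h2 := finite_jacobi_triple_product hs m
  have a1 := (pow_dvd_pow X (by omega)).trans (X_pow_dvd_finsum_sub_theta cubicTrace m)
    (a := (X : ℤ⟦X⟧) ^ (n + 1))
  have a2 := (pow_dvd_pow X (by omega)).trans (X_pow_dvd_finsum_sub_theta parity m)
    (a := (X : ℤ⟦X⟧) ^ (n + 1))
  have p1 : ∏ i ∈ Finset.range m, (1 + C (-1 : ℤ) * X ^ (2 * i + 1) + X ^ (4 * i + 2)) =
      ∏ i ∈ Finset.range m, (1 - X ^ (2 * i + 1) + X ^ (4 * i + 2)) :=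
    Finset.prod_congr rfl fun i _ => by rw [map_neg, map_one]; ring
  have p2 : ∏ i ∈ Finset.range m, (1 + C (-2 : ℤ) * X ^ (2 * i + 1) + X ^ (4 * i + 2)) =
      ∏ i ∈ Finset.range m, (1 - X ^ (2 * i + 1)) ^ 2 :=
    Finset.prod_congr rfl fun i _ => by rw [map_neg, map_ofNat]; ring
  rw [p1, show cubicTrace 0 = 2 from rfl, map_ofNat] at h1
  rw [p2, show parity 0 = 1 from rfl, map_one, one_mul] at h2
  rw [← h2] at hm
  set S := ∑ᶠ k, jacobiCoeff m k * (X ^ (k.natAbs ^ 2) * C (parity k))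
  set T := ∑ᶠ k, jacobiCoeff m k * (X ^ (k.natAbs ^ 2) * C (cubicTrace k))
  have hdvd : (X : ℤ⟦X⟧) ^ (n + 1) ∣ 2 * G * theta parity - theta cubicTrace := by
    have h3 := evenFactorial_mul_inv (2 * m)
    set r := invEvenFactorial ((2 * m : ℕ) : ℤ)
    set e := evenFactorial (2 * m)
    obtain ⟨x, hx⟩ := hm
    obtain ⟨y, hy⟩ := a1
    obtain ⟨z, hz⟩ := a2
    refine ⟨evenFactorial m ^ 2 * r * 2 * x - 2 * G * z + y, ?_⟩
    -- Multiplying by `r` cancels `e`, common to both triple products; the factor `evenFactorial m ^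
    -- 2` turns `S` and `T` into theta series modulo `X ^ (n + 1)`.
    linear_combination (evenFactorial m ^ 2 * r * 2) * hx - 2 * G * hz + hy
      - evenFactorial m ^ 2 * r * h1 - evenFactorial m ^ 2 * (2 * G * S - T) * h3
  rw [map_zero]
  exact X_pow_dvd_iff.1 hdvd n (by omega)

/-! ### The generating function of designated partitions -/

/-- The weight of a part of size `i` that occurs `c` times. -/
def designatedWeight (i c : ℕ) : ℤ := if Even i then 0 else c

/-- A partition into odd parts admits as many designations as the product of its multiplicities; an
even part contributes a factor zero. -/
theorem PD_two_eq_coeff (n : ℕ) :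
    (PD 2 n : ℤ) = coeff n (Nat.Partition.genFun designatedWeight) := by
  classical
  rw [Nat.Partition.coeff_genFun, PD]
  rw [Nat.card_sigma]
  have hp : ∀ p : {p : n.Partition // ∀ i ∈ p.parts, ¬ 2 ∣ i},
      Nat.card ((i : {i : ℕ // i ∈ p.1.parts}) → Fin (p.1.parts.count i.1)) =
        ∏ i ∈ p.1.parts.toFinset, p.1.parts.count i := by
    intro p
    have := Fintype.ofFinite {i : ℕ // i ∈ p.1.parts}
    rw [Nat.card_pi]
    simp only [Nat.card_fin]
    exact (Finset.prod_subtype _ (fun i => Multiset.mem_toFinset) fun i => p.1.parts.count i).symm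
  simp only [hp]
  rw [← Finset.sum_filter_of_ne (p := fun p : n.Partition => ∀ i ∈ p.parts, ¬ 2 ∣ i),
    Finset.sum_subtype (p := fun p : n.Partition => ∀ i ∈ p.parts, ¬ 2 ∣ i) _ (by simp)]
  · push_cast
    refine Finset.sum_congr rfl fun p _ => ?_
    rw [Finsupp.prod, Multiset.toFinsupp_support]
    refine Finset.prod_congr rfl fun i hi => ?_
    rw [designatedWeight, if_neg, Multiset.toFinsupp_apply]
    rw [even_iff_two_dvd]
    exact p.2 i (Multiset.mem_toFinset.1 hi)
  · intro p _ h i hi h2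
    refine h (Finset.prod_eq_zero (i := i) ?_ ?_)
    · rw [Multiset.toFinsupp_support, Multiset.mem_toFinset]
      exact hi
    · rw [designatedWeight, if_pos (even_iff_two_dvd.2 h2)]

open scoped PowerSeries.WithPiTopology in
theorem X_pow_dvd_genFun_designatedWeight (n : ℕ) : ∃ m, n ≤ m ∧ X ^ (n + 1) ∣
      Nat.Partition.genFun designatedWeight * ∏ i ∈ Finset.range m, (1 - X ^ (2 * i + 1)) ^ 2 -
        ∏ i ∈ Finset.range m, (1 - X ^ (2 * i + 1) + X ^ (4 * i + 2)) := by
  have h := Nat.Partition.hasProd_genFun designatedWeight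
  simp only [smul_eq_C_mul] at h
  set F : ℕ → ℤ⟦X⟧ := fun i =>
    1 + ∑' j, C (designatedWeight (i + 1) (j + 1)) * X ^ ((i + 1) * (j + 1)) with hF
  -- `F i` belongs to parts of size `i + 1`, so odd indices carry the even parts.
  have hodd : ∀ i, F (2 * i + 1) = 1 := by
    intro i
    have : Even (2 * i + 1 + 1) := ⟨i + 1, by ring⟩
    simp [hF, designatedWeight, this]
  have heven : ∀ i, F (2 * i) * (1 - X ^ (2 * i + 1)) ^ 2 =
      1 - X ^ (2 * i + 1) + X ^ (4 * i + 2) := by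
    intro i
    set Y : ℤ⟦X⟧ := X ^ (2 * i + 1) with hY
    have hs := Nat.Partition.summable_genFun_term' designatedWeight (i := 2 * i + 1) (by omega)
    have ht := Nat.Partition.summable_genFun_term' (fun _ _ => (1 : ℤ)) (i := 2 * i + 1) (by omega)
    have hw : ∀ j, designatedWeight (2 * i + 1) (j + 1) = (j : ℤ) + 1 := by
      intro j
      have : ¬ Even (2 * i + 1) := by simp
      simp [designatedWeight, this]
    simp only [smul_eq_C_mul, hw, pow_mul, ← hY, map_add, map_natCast, map_one, one_mul] at hs ht
    have h4 : (X : ℤ⟦X⟧) ^ (4 * i + 2) = Y ^ 2 := by rw [hY, ← pow_mul]; ring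
    rw [hF, h4]
    simp only [hw, pow_mul, ← hY, map_add, map_natCast, map_one]
    -- Division-free forms of `∑ Y^j = Y / (1 - Y)` and `∑ j Y^j = Y / (1 - Y)^2`, sums over `j ≥
    -- 1`; the factor is thus `1 + Y / (1 - Y)^2`.
    have hT : ∑' j : ℕ, Y ^ (j + 1) = Y + Y * ∑' j : ℕ, Y ^ (j + 1) := by
      conv_lhs => rw [ht.tsum_eq_zero_add]
      rw [← ht.tsum_mul_left]
      simp [pow_succ']
    have hS : ∑' j : ℕ, ((j : ℤ⟦X⟧) + 1) * Y ^ (j + 1) =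
        Y + Y * (∑' j : ℕ, ((j : ℤ⟦X⟧) + 1) * Y ^ (j + 1)) + Y * ∑' j : ℕ, Y ^ (j + 1) := by
      conv_lhs => rw [hs.tsum_eq_zero_add]
      rw [add_assoc, ← mul_add, ← hs.tsum_add ht, ← (hs.add ht).tsum_mul_left]
      congr 1
      · simp
      · refine tsum_congr fun j => ?_
        push_cast
        ring
    linear_combination (1 - Y) * hS + Y * hT
  have hprod : ∀ m, (∏ i ∈ Finset.range (2 * m), F i) *
      ∏ i ∈ Finset.range m, (1 - X ^ (2 * i + 1)) ^ 2 =
        ∏ i ∈ Finset.range m, (1 - X ^ (2 * i + 1) + X ^ (4 * i + 2)) := by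
    intro m
    induction m with
    | zero => simp
    | succ m ih =>
      rw [Finset.prod_range_succ, Finset.prod_range_succ, ← ih, show 2 * (m + 1) = 2 * m + 1 + 1 by
        ring, Finset.prod_range_succ, Finset.prod_range_succ, hodd, ← heven]
      ring
  have hlim := h.comp ((Filter.tendsto_finset_range).comp
    (Filter.tendsto_id.const_mul_atTop' (show 0 < 2 by norm_num)))
  rw [PowerSeries.WithPiTopology.tendsto_iff_coeff_tendsto] at hlim
  have hev : ∀ᶠ m in Filter.atTop, ∀ k ∈ Finset.range (n + 1),
      coeff k (∏ i ∈ Finset.range (2 * m), F i) =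
        coeff k (Nat.Partition.genFun designatedWeight) := by
    rw [Filter.eventually_all_finset]
    intro k _
    have := hlim k
    -- The coefficients lie in the discrete space `ℤ`, so convergence means being eventually equal.
    rw [nhds_discrete, Filter.tendsto_pure] at this
    exact this
  obtain ⟨m, hm, hnm⟩ := (hev.and (Filter.eventually_ge_atTop n)).exists
  refine ⟨m, hnm, ?_⟩
  rw [← hprod, ← sub_mul]
  refine Dvd.dvd.mul_right (X_pow_dvd_iff.2 fun k hk => ?_) _
  rw [map_sub, hm k (Finset.mem_range.2 hk), sub_self]

theorem mainTheorem3 (n : ℕ) : PD 2 (16 * n) ≡ PD 2 (4 * n) [MOD 8] := by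
  obtain ⟨hU, K, L, hV, hK⟩ :=
    dissection_of_theta (two_mul_mul_theta_parity X_pow_dvd_genFun_designatedWeight)
  have h := (natCast_dvd_iff_coeff 8 _).1 (by exact_mod_cast eight_dvd_of_dissection hU hV hK) n
  simp only [map_sub, coeff_evenPart, ← PD_two_eq_coeff] at h
  rw [show 2 * (2 * (2 * (2 * n))) = 16 * n by ring, show 2 * (2 * n) = 4 * n by ring] at h
  exact (Nat.modEq_iff_dvd.2 h).symm
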